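/- **Theorem 3.3.** Let $d\ge 1$, $N\ge 0$ and $\kappa\in\mathbb R^{d+1}$ with $\kappa_i>-1$ for all $i$. Write $|\kappa|=\kappa_1+\dots+\kappa_{d+1}$, $\mathbf 1=(1,\dots,1)$, $(a)_k=a(a+1)\cdots(a+k-1)$, $(a)_\alpha=\prod_i(a_i)_{\alpha_i}$, $|\alpha|=\sum_i\alpha_i$, $\alpha!=\prod_i\alpha_i!$ and $\mathbb Z_N^{d+1}=\{\alpha\in\mathbb N_0^{d+1}:|\alpha|=N\}$. For functions $f,g$ on $\mathbb Z_N^{d+1}$ let $$\langle f,g\rangle_{\mathsf H_{\kappa,N}}=\frac{N!}{(|\kappa|+d+1)_N}\sum_{x\in\mathbb Z_N^{d+1}}f(x)g(x)\frac{(\kappa+\mathbf 1)_x}{x!}.$$ Regard polynomials in the coordinates $x_1,\dots,x_d$ as functions on $\mathbb Z_N^{d+1}$. For $0\le n\le N$ let $\mathcal V_n^d(\mathsf H_{\kappa,N})$ be the space of polynomials of total degree at most $n$ that are orthogonal, for this inner product, to all polynomials of total degree less than $n$. Let $\mathsf P_n(\mathsf H_{\kappa,N};\cdot,\cdot)$ be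 its reproducing kernel: the function on $\mathbb Z_N^{d+1}\times\mathbb Z_N^{d+1}$ that belongs to $\mathcal V_n^d(\mathsf H_{\kappa,N})$ in either variable and satisfies $\langle \mathsf P_n(\mathsf H_{\kappa,N};x,\cdot),p\rangle_{\mathsf H_{\kappa,N}}=p(x)$ for all $p\in\mathcal V_n^d(\mathsf H_{\kappa,N})$ and all $x$. For $\alpha\in\mathbb N_0^{d+1}$ with $n\le|\alpha|\le N$ let $$\mathsf Q_{\alpha,n}(\cdot;\kappa,N)=\frac1{(\kappa+\mathbf 1)_\alpha}\,\mathrm{proj}_{\mathcal V_n^d(\mathsf H_{\kappa,N})}\mathrm m_\alpha,\qquad \mathrm m_\alpha(x)=(-1)^{|\alpha|}(-x)_\alpha=(-1)^{|\alpha|}\prod_{i=1}^{d+1}(-x_i)_{\alpha_i},$$ where $\mathrm{proj}$ is the orthogonal projection for $\langle\cdot,\cdot\rangle_{\mathsf H_{\kappa,N}}$. Then for all integers $0\le n\le m\le N$ and all $x,y\in\mathbb Z_N^{d+1}$, $$\mathsf P_n(\mathsf H_{\kappa,N};x,y)=\mathsf D_n(m,N)\sum_{\alpha\in\mathbb N_0^{d+1},\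 |\alpha|=m}\frac{(\kappa+\mathbf 1)_\alpha}{\alpha!}\,\mathsf Q_{\alpha,n}(x;\kappa,N)\,\mathsf Q_{\alpha,n}(y;\kappa,N),$$ where $$\mathsf D_n(m,N)=\frac{(-N)_n\,m!\,(|\kappa|+d+1)_N\,(|\kappa|+d+1)_{m+n}}{(-m)_n\,[(-N)_m]^2\,(|\kappa|+d+1)_{N+n}}.$$ -/

import Mathlib

noncomputable section

open scoped BigOperators

namespace HahnFrame

/-- The admissible parameters `κ = (κ₁, …, κ_{d+1})`: real vectors with all entries `> -1`. -/
abbrev Param (d : ℕ) : Type := {κ : Fin (d + 1) → ℝ // ∀ i, -1 < κ i}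

/-- The finite set of `α ∈ ℕ₀^{d+1}` with `|α| = N` (the discrete simplex). -/
def grid (d N : ℕ) : Finset (Fin (d + 1) → ℕ) :=
  Finset.piAntidiag Finset.univ N

theorem mem_grid {d N : ℕ} {α : Fin (d + 1) → ℕ} : α ∈ grid d N ↔ ∑ i, α i = N := by
  simp [grid]

/-- The Pochhammer symbol `(a)_n = a (a + 1) ⋯ (a + n - 1)`. -/
def poch (a : ℝ) (n : ℕ) : ℝ := ∏ i ∈ Finset.range n, (a + i)

/-- The multivariate Pochhammer symbol `(a)_α = ∏ᵢ (aᵢ)_{αᵢ}`. -/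
def mpoch {k : ℕ} (a : Fin k → ℝ) (α : Fin k → ℕ) : ℝ := ∏ i, poch (a i) (α i)

/-- The multi-index factorial `α! = ∏ᵢ αᵢ!`. -/
def mfact {k : ℕ} (α : Fin k → ℕ) : ℝ := ∏ i, ((α i).factorial : ℝ)

/-- `λ_κ = |κ| + d + 1`, where `|κ| = κ₁ + ⋯ + κ_{d+1}`. -/
def lam {d : ℕ} (κ : Param d) : ℝ := (∑ i, κ.1 i) + d + 1

/-- `(κ + 𝟏)_α`. -/
def kpoch {d : ℕ} (κ : Param d) (α : Fin (d + 1) → ℕ) : ℝ := mpoch (fun i => κ.1 i + 1) α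

/-- The Hahn weight `H_κ(x) = (κ + 𝟏)_x / x!`. -/
def hahnWeight {d : ℕ} (κ : Param d) (x : Fin (d + 1) → ℕ) : ℝ := kpoch κ x / mfact x

/-- The Hahn inner product of two functions on the discrete simplex,
`⟨f, g⟩ = N! / (|κ| + d + 1)_N * ∑_{|x| = N} f(x) g(x) H_κ(x)`. -/
def hahnInner {d : ℕ} (κ : Param d) (N : ℕ) (f g : grid d N → ℝ) : ℝ :=
  (N.factorial : ℝ) / poch (lam κ) N * ∑ x : grid d N, f x * g x * hahnWeight κ x

theorem poch_pos {a : ℝ} (ha : 0 < a) (n : ℕ) : 0 < poch a n :=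
  Finset.prod_pos fun i _ => by positivity

theorem hahnWeight_pos {d : ℕ} (κ : Param d) (x : Fin (d + 1) → ℕ) : 0 < hahnWeight κ x := by
  have h1 : 0 < kpoch κ x := by
    unfold kpoch mpoch
    exact Finset.prod_pos fun i _ => poch_pos (by linarith [κ.2 i]) _
  have h2 : 0 < mfact x := Finset.prod_pos fun i _ => by exact_mod_cast Nat.factorial_pos _
  exact div_pos h1 h2

theorem lam_pos {d : ℕ} (κ : Param d) : 0 < lam κ := by
  have h : 0 < ∑ i, (κ.1 i + 1) :=
    Finset.sum_pos (fun i _ => by have := κ.2 i; linarith) Finset.univ_nonempty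
  simp only [Finset.sum_add_distrib, Finset.sum_const, Finset.card_univ, Fintype.card_fin,
    nsmul_eq_mul, mul_one, Nat.cast_add, Nat.cast_one] at h
  unfold lam
  linarith

theorem hahnConst_pos {d : ℕ} (κ : Param d) (N : ℕ) :
    0 < (N.factorial : ℝ) / poch (lam κ) N :=
  div_pos (by exact_mod_cast Nat.factorial_pos _) (poch_pos (lam_pos κ) _)

/-- The space of real functions on the discrete simplex `{x ∈ ℕ₀^{d+1} : |x| = N}`, which carries
the Hahn inner product with parameter `κ`. Through `x_{d+1} = N - x₁ - ⋯ - x_d`, restriction to the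
discrete simplex identifies the polynomials in `x₁, …, x_d` of degree at most `N` with these
functions. -/
def HahnSpace {d : ℕ} (_κ : Param d) (N : ℕ) : Type := grid d N → ℝ

namespace HahnSpace

variable {d : ℕ} (κ : Param d) (N : ℕ)

/-- A function on the discrete simplex, as an element of the Hahn space. -/
def of (f : grid d N → ℝ) : HahnSpace κ N := f

instance : AddCommGroup (HahnSpace κ N) := inferInstanceAs (AddCommGroup (grid d N → ℝ))

instance : Module ℝ (HahnSpace κ N) := inferInstanceAs (Module ℝ (grid d N → ℝ))

instance : FiniteDimensional ℝ (HahnSpace κ N) :=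
  inferInstanceAs (FiniteDimensional ℝ (grid d N → ℝ))

instance : CoeFun (HahnSpace κ N) (fun _ => grid d N → ℝ) := ⟨fun f => f⟩

/-- The Hahn inner product is a positive definite inner product. -/
@[reducible]
def innerCore : InnerProductSpace.Core ℝ (HahnSpace κ N) where
  inner f g := hahnInner κ N f g
  conj_inner_symm f g := by
    simp only [hahnInner, conj_trivial]
    congr 1
    exact Finset.sum_congr rfl fun x _ => by ring
  re_inner_nonneg f := by
    refine mul_nonneg (hahnConst_pos κ N).le (Finset.sum_nonneg fun x _ => ?_)
    exact mul_nonneg (mul_self_nonneg _) (hahnWeight_pos κ x).le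
  add_left f g h := by
    simp only [hahnInner]
    rw [← mul_add, ← Finset.sum_add_distrib]
    congr 1
    refine Finset.sum_congr rfl fun x _ => ?_
    change (f x + g x) * h x * _ = _
    ring
  smul_left f g r := by
    simp only [hahnInner, conj_trivial]
    rw [mul_left_comm, Finset.mul_sum _ _ r]
    congr 1
    refine Finset.sum_congr rfl fun x _ => ?_
    change (r * f x) * g x * _ = _
    ring
  definite f hf := by
    have h := (mul_eq_zero.mp hf).resolve_left (hahnConst_pos κ N).ne'
    have h' := (Finset.sum_eq_zero_iff_of_nonneg fun (x : grid d N) _ =>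
      mul_nonneg (mul_self_nonneg (f x)) (hahnWeight_pos κ x.1).le).mp h
    funext x
    exact mul_self_eq_zero.mp
      ((mul_eq_zero.mp (h' x (Finset.mem_univ x))).resolve_right (hahnWeight_pos κ x.1).ne')

instance : NormedAddCommGroup (HahnSpace κ N) :=
  @InnerProductSpace.Core.toNormedAddCommGroup ℝ (HahnSpace κ N) _ _ _ (innerCore κ N)

instance : InnerProductSpace ℝ (HahnSpace κ N) :=
  InnerProductSpace.ofCore (innerCore κ N).toCore

theorem inner_eq (f g : HahnSpace κ N) : inner ℝ f g = hahnInner κ N f g := rfl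

/-- Restriction to the discrete simplex of a polynomial in the first `d` coordinates. -/
def restrict : MvPolynomial (Fin d) ℝ →ₗ[ℝ] HahnSpace κ N where
  toFun p := of κ N fun x => MvPolynomial.eval (fun i : Fin d => (x.1 i.castSucc : ℝ)) p
  map_add' p q := by funext x; exact map_add _ p q
  map_smul' c p := by funext x; exact MvPolynomial.smul_eval _ p c

/-- Point evaluation at `x`, as a linear functional. -/
def evalAt (x : grid d N) : HahnSpace κ N →ₗ[ℝ] ℝ where
  toFun f := f x
  map_add' _ _ := rfl
  map_smul' _ _ := rfl

end HahnSpace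

/-- The space `Π_n^d` of polynomials of total degree at most `n` in `d` variables, as functions on
the discrete simplex. -/
def polySpace {d : ℕ} (κ : Param d) (N n : ℕ) : Submodule ℝ (HahnSpace κ N) :=
  (MvPolynomial.restrictTotalDegree (Fin d) ℝ n).map (HahnSpace.restrict κ N)

/-- The space `V_n^d` of orthogonal polynomials of degree `n` for the Hahn inner product: the
elements of `Π_n^d` that are orthogonal to `Π_{n-1}^d` (which is `{0}` for `n = 0`). -/
def orthoSpace {d : ℕ} (κ : Param d) (N n : ℕ) : Submodule ℝ (HahnSpace κ N) where
  carrier := {f | f ∈ polySpace κ N n ∧ ∀ k < n, ∀ g ∈ polySpace κ N k, inner ℝ f g = 0}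
  add_mem' := by
    rintro f g ⟨hf, hf'⟩ ⟨hg, hg'⟩
    refine ⟨add_mem hf hg, fun k hk p hp => ?_⟩
    rw [inner_add_left, hf' k hk p hp, hg' k hk p hp, add_zero]
  zero_mem' := ⟨zero_mem _, fun k hk p hp => inner_zero_left p⟩
  smul_mem' := by
    rintro c f ⟨hf, hf'⟩
    refine ⟨Submodule.smul_mem _ c hf, fun k hk p hp => ?_⟩
    rw [real_inner_smul_left, hf' k hk p hp, mul_zero]

/-- The shifted monomial `m_α(x) = (-1)^{|α|} (-x)_α` on the discrete simplex. -/
def shiftedMonomial {d : ℕ} (κ : Param d) (N : ℕ) (α : Fin (d + 1) → ℕ) : HahnSpace κ N :=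
  HahnSpace.of κ N fun x => (-1) ^ (∑ i, α i) * mpoch (fun i => -(x.1 i : ℝ)) α

/-- `Q_{α,n}(x; κ, N) = (1 / (κ + 𝟏)_α) proj_{V_n^d} m_α(x)`, where `proj` is the orthogonal
projection onto `V_n^d` for the Hahn inner product. -/
def hahnQ {d : ℕ} (κ : Param d) (N n : ℕ) (α : Fin (d + 1) → ℕ) : HahnSpace κ N :=
  (1 / kpoch κ α) • (orthoSpace κ N n).starProjection (shiftedMonomial κ N α)

/-- The Riesz representer in `V`, for the Hahn inner product, of the evaluation `p ↦ p(x)`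
on a subspace `V` of the Hahn space. -/
def evalRepresenter {d : ℕ} {κ : Param d} {N : ℕ} (V : Submodule ℝ (HahnSpace κ N))
    (x : grid d N) : V :=
  (InnerProductSpace.toDual ℝ V).symm
    (LinearMap.toContinuousLinearMap ((HahnSpace.evalAt κ N x).comp V.subtype))

/-- The reproducing kernel `P(x, y)` of a subspace `V` of the Hahn space: `P(x, ·)` is the Riesz
representer in `V` of the evaluation `p ↦ p(x)` on `V`. -/
def reproducingKernel {d : ℕ} {κ : Param d} {N : ℕ} (V : Submodule ℝ (HahnSpace κ N))
    (x y : grid d N) : ℝ :=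
  (evalRepresenter V x : HahnSpace κ N) y

/-- The reproducing kernel of `V` is the unique function of two variables that lies in `V` in
either variable and reproduces the elements of `V`. -/
theorem eq_reproducingKernel_iff {d : ℕ} {κ : Param d} {N : ℕ}
    (V : Submodule ℝ (HahnSpace κ N)) (K : grid d N → grid d N → ℝ) :
    K = reproducingKernel V ↔
      (∀ x, HahnSpace.of κ N (fun y => K x y) ∈ V) ∧
      (∀ y, HahnSpace.of κ N (fun x => K x y) ∈ V) ∧
      ∀ p ∈ V, ∀ x, inner ℝ (HahnSpace.of κ N (fun y => K x y)) p = p x := by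
  have hr : ∀ x, ∀ p ∈ V, inner ℝ (evalRepresenter V x : HahnSpace κ N) p = p x := by
    intro x p hp
    exact InnerProductSpace.toDual_symm_apply (𝕜 := ℝ) (E := V) (x := ⟨p, hp⟩)
      (y := LinearMap.toContinuousLinearMap ((HahnSpace.evalAt κ N x).comp V.subtype))
  have hm : ∀ x, (evalRepresenter V x : HahnSpace κ N) ∈ V := fun x => Subtype.coe_prop _
  have hs : ∀ x y, reproducingKernel V x y = reproducingKernel V y x := by
    intro x y
    have h1 := hr x _ (hm y)
    have h2 := hr y _ (hm x)
    rw [real_inner_comm] at h2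
    exact h2.symm.trans h1
  constructor
  · rintro rfl
    refine ⟨hm, fun y => ?_, fun p hp x => hr x p hp⟩
    have : HahnSpace.of κ N (fun x => reproducingKernel V x y) = evalRepresenter V y :=
      funext fun x => hs x y
    rw [this]
    exact hm y
  · rintro ⟨h1, -, h3⟩
    funext x
    have h := sub_mem (h1 x) (hm x)
    have h0 := h3 _ h x
    rw [← hr x _ h, ← sub_eq_zero, ← inner_sub_left, inner_self_eq_zero, sub_eq_zero] at h0
    exact h0

/-- The constant
`D_n(m, N) = (-N)_n m! (λ_κ)_N (λ_κ)_{m+n} / ((-m)_n [(-N)_m]² (λ_κ)_{N+n})`,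
with `λ_κ = |κ| + d + 1`. -/
def constD {d : ℕ} (κ : Param d) (n m N : ℕ) : ℝ :=
  (poch (-(N : ℝ)) n * (m.factorial : ℝ) * poch (lam κ) N * poch (lam κ) (m + n)) /
    (poch (-(m : ℝ)) n * poch (-(N : ℝ)) m ^ 2 * poch (lam κ) (N + n))

end HahnFrame

end

noncomputable section

open scoped BigOperators

namespace HahnFrame

section

/-! ### Pochhammer symbols and the Chu–Vandermonde identity -/

/-! The kernel is characterised by membership in `V_n` and the reproducing property, so it suffices
to show that `f ↦ ∑ (κ + 𝟏)_α / α! ⟨Q_{α,n}, f⟩ Q_{α,n}` is multiplication by `1 / D_n(m, N)` on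
`V_n`. The orthogonal projection is self-adjoint and fixes `f ∈ V_n`, so this sum is the projection
onto `V_n` of `T f`, with `T = synthesis ∘ analysis` passing through functions on the simplex of
size `m`.

Both factors preserve degree and have known leading behaviour: by Chu–Vandermonde, `synthesis`
multiplies each falling product `m_β` by a scalar depending only on `|β|`
(`synthesis_shiftedMonomial`), and `analysis` does the same to the rising products `(κ + 𝟏 + x)_β`
(`analysis_risingMonomial`). The two families differ, but both have leading monomial `x^β`; hence
modulo lower degree each factor is a scalar on polynomials of degree at most `n`
(`sub_smul_mem_map_degreeLT`), and so is `T`. Projection to `V_n` kills the lower-degree remainder,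
and the product of the two scalars is `1 / D_n(m, N)` (`constD_mul_coeff`). -/

theorem poch_zero (a : ℝ) : poch a 0 = 1 := by simp [poch]

theorem poch_succ (a : ℝ) (n : ℕ) : poch a (n + 1) = poch a n * (a + n) :=
  Finset.prod_range_succ _ _

theorem poch_add (a : ℝ) (m n : ℕ) : poch a (m + n) = poch a m * poch (a + m) n := by
  unfold poch
  rw [Finset.prod_range_add]
  congr 1
  exact Finset.prod_congr rfl fun i _ => by push_cast; ring

theorem neg_one_pow_mul_poch_neg (a : ℝ) (n : ℕ) :
    (-1) ^ n * poch (-a) n = ∏ j ∈ Finset.range n, (a - j) := by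
  unfold poch
  conv_lhs => rw [← Finset.card_range n, ← Finset.prod_const, Finset.card_range,
    ← Finset.prod_mul_distrib]
  exact Finset.prod_congr rfl fun j _ => by ring

theorem neg_one_pow_mul_poch_neg_natCast (a n : ℕ) :
    (-1) ^ n * poch (-(a : ℝ)) n = a.descFactorial n := by
  rw [neg_one_pow_mul_poch_neg]
  induction n with
  | zero => simp
  | succ n ih =>
    rw [Finset.prod_range_succ, ih, Nat.descFactorial_succ]
    rcases le_or_gt n a with h | h
    · push_cast [Nat.cast_sub h]; ring
    · simp [Nat.descFactorial_eq_zero_iff_lt.mpr h]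

theorem poch_neg_natCast (a n : ℕ) :
    poch (-(a : ℝ)) n = (-1) ^ n * a.descFactorial n := by
  rw [← neg_one_pow_mul_poch_neg_natCast, ← mul_assoc, ← mul_pow]
  simp

/-- Links `pochSeries` to the binomial series of exponent `-a`, evaluated at `-t`. -/
theorem poch_div_factorial (a : ℝ) (n : ℕ) :
    poch a n / n.factorial = (-1) ^ n * Ring.choose (-a) n := by
  have h := Ring.descPochhammer_eq_factorial_smul_choose (-a) n
  rw [nsmul_eq_mul] at h
  have h2 : ∀ n : ℕ, (descPochhammer ℤ n).smeval (-a) = (-1) ^ n * poch a n := by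
    intro n
    induction n with
    | zero => simp [poch]
    | succ n ih =>
      rw [descPochhammer_succ_right, Polynomial.smeval_mul, ih, poch_succ, Polynomial.smeval_sub,
        Polynomial.smeval_X, Polynomial.smeval_natCast]
      simp
      ring
  rw [h2] at h
  have hn : (n.factorial : ℝ) ≠ 0 := by exact_mod_cast n.factorial_ne_zero
  rw [div_eq_iff hn, mul_assoc, mul_comm (Ring.choose _ _), ← h, ← mul_assoc, ← mul_pow]
  simp

/-- The power series `∑ (a)_k / k! t^k`, which represents `(1 - t)^{-a}`. -/
def pochSeries (a : ℝ) : PowerSeries ℝ := PowerSeries.mk fun k => poch a k / k.factorial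

theorem pochSeries_add (a b : ℝ) : pochSeries (a + b) = pochSeries a * pochSeries b := by
  have h : ∀ a, pochSeries a =
      PowerSeries.rescale (-1) (PowerSeries.binomialSeries ℝ (-a)) := by
    intro a
    ext n
    simp [pochSeries, PowerSeries.coeff_rescale, poch_div_factorial]
  rw [h, h, h, neg_add, PowerSeries.binomialSeries_add, map_mul]

theorem pochSeries_zero : pochSeries 0 = 1 := by
  ext n
  rcases n with _ | n
  · simp [pochSeries, poch]
  · simp [pochSeries, poch, Finset.prod_range_succ', PowerSeries.coeff_one]

theorem pochSeries_sum {ι : Type*} (s : Finset ι) (a : ι → ℝ) :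
    pochSeries (∑ i ∈ s, a i) = ∏ i ∈ s, pochSeries (a i) := by
  classical
  induction s using Finset.induction_on with
  | empty => simp [pochSeries_zero]
  | insert i s hi ih => rw [Finset.sum_insert hi, Finset.prod_insert hi, pochSeries_add, ih]

/-- The multivariate Chu–Vandermonde identity. -/
theorem sum_mpoch_div_mfact {d : ℕ} (a : Fin (d + 1) → ℝ) (M : ℕ) :
    ∑ z ∈ grid d M, mpoch a z / mfact z = poch (∑ i, a i) M / M.factorial := by
  have h := congrArg (PowerSeries.coeff M) (pochSeries_sum Finset.univ a)
  rw [PowerSeries.coeff_prod] at h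
  simp only [pochSeries, PowerSeries.coeff_mk] at h
  rw [h]
  refine (Finset.sum_nbij' (fun l : Fin (d + 1) →₀ ℕ => (l : Fin (d + 1) → ℕ))
    -- The coefficient of a product of power series is indexed by finitely supported functions,
    -- `grid` by plain functions.
    (fun z => Finsupp.equivFunOnFinite.symm z) ?_ ?_ ?_ ?_ ?_).symm
  · intro l hl; simpa [mem_grid] using hl
  · intro z hz; simpa [mem_grid] using hz
  · intro l _; ext; simp
  · intro z _; ext; simp
  · intro l _; simp [mpoch, mfact, Finset.prod_div_distrib]

/-! ### Multi-indices -/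

theorem mpoch_add {k : ℕ} (a : Fin k → ℝ) (α β : Fin k → ℕ) :
    mpoch a (α + β) = mpoch a α * mpoch (fun i => a i + α i) β := by
  unfold mpoch
  rw [← Finset.prod_mul_distrib]
  exact Finset.prod_congr rfl fun i _ => poch_add _ _ _

theorem mfact_pos {k : ℕ} (α : Fin k → ℕ) : 0 < mfact α :=
  Finset.prod_pos fun i _ => by exact_mod_cast Nat.factorial_pos _

theorem kpoch_pos {d : ℕ} (κ : Param d) (α : Fin (d + 1) → ℕ) : 0 < kpoch κ α := by
  unfold kpoch mpoch
  exact Finset.prod_pos fun i _ => poch_pos (by linarith [κ.2 i]) _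

/-- `m_α(x) = ∏ᵢ xᵢ! / (xᵢ - αᵢ)!` in terms of the coordinates of `x`. -/
theorem neg_one_pow_mul_mpoch_neg {k : ℕ} (x α : Fin k → ℕ) :
    (-1) ^ (∑ i, α i) * mpoch (fun i => -(x i : ℝ)) α =
      ∏ i, ((x i).descFactorial (α i) : ℝ) := by
  unfold mpoch
  rw [← Finset.prod_pow_eq_pow_sum, ← Finset.prod_mul_distrib]
  exact Finset.prod_congr rfl fun i _ => neg_one_pow_mul_poch_neg_natCast _ _

theorem prod_descFactorial_eq_zero {k : ℕ} {x α : Fin k → ℕ} (h : ¬ α ≤ x) :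
    ∏ i, ((x i).descFactorial (α i) : ℝ) = 0 := by
  obtain ⟨i, hi⟩ : ∃ i, x i < α i := by simpa [Pi.le_def] using h
  exact Finset.prod_eq_zero (Finset.mem_univ i)
    (by rw [Nat.descFactorial_eq_zero_iff_lt.mpr hi, Nat.cast_zero])

/-- The factor `m_α(x) / x!` at `x = α + z` becomes `1 / z!`, which turns both operator sums into
Chu–Vandermonde sums over `z`. -/
theorem prod_descFactorial_add_div_mfact {k : ℕ} (α z : Fin k → ℕ) :
    (∏ i, (((α + z) i).descFactorial (α i) : ℝ)) / mfact (α + z) = 1 / mfact z := by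
  rw [div_eq_div_iff (mfact_pos _).ne' (mfact_pos _).ne', one_mul]
  unfold mfact
  rw [← Finset.prod_mul_distrib]
  refine Finset.prod_congr rfl fun i _ => ?_
  have := Nat.factorial_mul_descFactorial (n := (α + z) i) (k := α i) (by simp)
  rw [← this]
  simp [mul_comm]

/-- Sums over the multi-indices of length `N` above a fixed one of length `m`. -/
theorem sum_grid_eq_sum_add {d m N : ℕ} (hmN : m ≤ N) {α : Fin (d + 1) → ℕ} (hα : α ∈ grid d m)
    (F : (Fin (d + 1) → ℕ) → ℝ) (hF : ∀ x, ¬ α ≤ x → F x = 0) :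
    ∑ x ∈ grid d N, F x = ∑ z ∈ grid d (N - m), F (α + z) := by
  symm
  refine Finset.sum_of_injOn (fun z => α + z) ?_ ?_ ?_ ?_
  · intro z _ w _ h; exact add_left_cancel h
  · intro z hz
    simp only [Finset.mem_coe, mem_grid] at hz hα ⊢
    simp only [Pi.add_apply, Finset.sum_add_distrib, hz, hα]
    omega
  · intro x hx hx'
    refine hF x fun hle => hx' ⟨x - α, ?_, ?_⟩
    · simp only [Finset.mem_coe, mem_grid] at hx hα ⊢
      have : ∑ i, (x - α) i + ∑ i, α i = ∑ i, x i := by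
        rw [← Finset.sum_add_distrib]
        exact Finset.sum_congr rfl fun i _ => Nat.sub_add_cancel (hle i)
      omega
    · exact add_tsub_cancel_of_le hle
  · intro z _; rfl

/-! ### Two operators between Hahn spaces -/

variable {d : ℕ} (κ : Param d) (m N : ℕ)

/-- The operator `g ↦ ∑_{|α| = m} g(α) m_α / α!`. -/
def synthesis : HahnSpace κ m →ₗ[ℝ] HahnSpace κ N where
  toFun g := ∑ α : grid d m, (g α / mfact α.1) • shiftedMonomial κ N α.1
  map_add' f g := by
    rw [← Finset.sum_add_distrib]
    refine Finset.sum_congr rfl fun α _ => ?_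
    rw [← add_smul]
    congr 1
    exact add_div _ _ _
  map_smul' c g := by
    rw [RingHom.id_apply, Finset.smul_sum]
    refine Finset.sum_congr rfl fun α _ => ?_
    rw [smul_smul]
    congr 1
    exact mul_div_assoc _ _ _

/-- The operator `f ↦ (α ↦ ⟨m_α, f⟩ / (κ + 𝟏)_α)`. -/
def analysis : HahnSpace κ N →ₗ[ℝ] HahnSpace κ m where
  toFun f := HahnSpace.of κ m fun α => inner ℝ (shiftedMonomial κ N α.1) f / kpoch κ α.1
  map_add' f g := by
    funext α
    change inner ℝ (shiftedMonomial κ N α.1) (f + g) / kpoch κ α.1 =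
      inner ℝ (shiftedMonomial κ N α.1) f / kpoch κ α.1 +
        inner ℝ (shiftedMonomial κ N α.1) g / kpoch κ α.1
    rw [inner_add_right, add_div]
  map_smul' c g := by
    funext α
    change inner ℝ (shiftedMonomial κ N α.1) (c • g) / kpoch κ α.1 =
      c * (inner ℝ (shiftedMonomial κ N α.1) g / kpoch κ α.1)
    rw [inner_smul_right, mul_div_assoc]

theorem sum_apply {ι : Type*} (s : Finset ι) (f : ι → HahnSpace κ N) (x : grid d N) :
    (∑ i ∈ s, f i) x = ∑ i ∈ s, f i x := map_sum (HahnSpace.evalAt κ N x) f s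

/-- The eigenvalue of `synthesis` on the shifted monomials of degree `k`. -/
def synthesisCoeff (k m N : ℕ) : ℝ :=
  (-1) ^ (m - k) * poch (-((N : ℝ) - k)) (m - k) / (m - k).factorial

/-- Only `α = β + z` contribute, since `m_β(α) = 0` unless `β ≤ α`. Splitting `(-x)_{β+z} = (-x)_β
(-x+β)_z` leaves a Chu–Vandermonde sum whose parameters add up to `k - N`, independently of `x`. -/
theorem synthesis_shiftedMonomial {k : ℕ} (hk : k ≤ m) {β : Fin (d + 1) → ℕ}
    (hβ : β ∈ grid d k) :
    synthesis κ m N (shiftedMonomial κ m β) =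
      synthesisCoeff k m N • shiftedMonomial κ N β := by
  funext x
  have h1 : synthesis κ m N (shiftedMonomial κ m β) x =
      ∑ α ∈ grid d m, ((-1) ^ (∑ i, β i) * mpoch (fun i => -(α i : ℝ)) β) / mfact α *
        ((-1) ^ (∑ i, α i) * mpoch (fun i => -(x.1 i : ℝ)) α) := by
    rw [← Finset.sum_coe_sort]
    exact sum_apply κ N _ _ x
  rw [h1, sum_grid_eq_sum_add hk hβ]
  · change _ = synthesisCoeff k m N * ((-1) ^ (∑ i, β i) * mpoch (fun i => -(x.1 i : ℝ)) β)
    have hsum : (∑ i, (-(x.1 i : ℝ) + β i)) = -((N : ℝ) - k) := by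
      rw [Finset.sum_add_distrib, Finset.sum_neg_distrib]
      have hx : ∑ i, (x.1 i : ℝ) = N := by exact_mod_cast mem_grid.mp x.2
      have hb : ∑ i, (β i : ℝ) = k := by exact_mod_cast mem_grid.mp hβ
      rw [hx, hb]
      ring
    rw [synthesisCoeff, ← hsum, mul_div_assoc, ← sum_mpoch_div_mfact, Finset.mul_sum,
      Finset.sum_mul]
    refine Finset.sum_congr rfl fun z hz => ?_
    rw [neg_one_pow_mul_mpoch_neg, prod_descFactorial_add_div_mfact, mpoch_add]
    simp only [Pi.add_apply, Finset.sum_add_distrib, mem_grid.mp hz, pow_add]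
    ring
  · intro α hα
    rw [neg_one_pow_mul_mpoch_neg, prod_descFactorial_eq_zero hα, zero_div, zero_mul]

/-- The eigenvalue of `analysis` on the functions `(κ + 𝟏 + x)_β` with `|β| = k`. -/
def analysisCoeff (k : ℕ) : ℝ :=
  (N.factorial : ℝ) / poch (lam κ) N *
    (poch (lam κ + m + k) (N - m) / (N - m).factorial)

/-- The function `x ↦ (κ + 𝟏 + x)_β`. -/
def risingMonomial (β : Fin (d + 1) → ℕ) : HahnSpace κ N :=
  HahnSpace.of κ N fun x => mpoch (fun i => κ.1 i + 1 + x.1 i) β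

/-- The factor `m_α` restricts the sum to `x = α + z`. Moving `(κ + 𝟏 + α)_β` outside leaves a
Chu–Vandermonde sum with parameters `κ + 𝟏 + α + β`, whose total depends only on `|α| = m` and `|β|
= k`. -/
theorem analysis_risingMonomial {k : ℕ} (hmN : m ≤ N) {β : Fin (d + 1) → ℕ}
    (hβ : β ∈ grid d k) :
    analysis κ m N (risingMonomial κ N β) = analysisCoeff κ m N k • risingMonomial κ m β := by
  funext α
  have h1 : inner ℝ (shiftedMonomial κ N α.1) (risingMonomial κ N β) =
      (N.factorial : ℝ) / poch (lam κ) N * ∑ x ∈ grid d N,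
        ((-1) ^ (∑ i, α.1 i) * mpoch (fun i => -(x i : ℝ)) α.1) *
          mpoch (fun i => κ.1 i + 1 + x i) β * hahnWeight κ x := by
    rw [← Finset.sum_coe_sort]
    rfl
  change inner ℝ (shiftedMonomial κ N α.1) (risingMonomial κ N β) / kpoch κ α.1 =
    analysisCoeff κ m N k * mpoch (fun i => κ.1 i + 1 + α.1 i) β
  rw [h1, sum_grid_eq_sum_add hmN α.2]
  · have hsum : (∑ i, (κ.1 i + 1 + α.1 i + β i)) = lam κ + m + k := by
      have ha : ∑ i, (α.1 i : ℝ) = m := by exact_mod_cast mem_grid.mp α.2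
      have hb : ∑ i, (β i : ℝ) = k := by exact_mod_cast mem_grid.mp hβ
      rw [lam, ← ha, ← hb]
      simp only [Finset.sum_add_distrib, Finset.sum_const, Finset.card_univ, Fintype.card_fin,
        nsmul_eq_mul]
      push_cast
      ring
    rw [analysisCoeff, ← hsum, ← sum_mpoch_div_mfact, mul_div_assoc, mul_assoc, Finset.sum_div,
      Finset.sum_mul]
    congr 1
    refine Finset.sum_congr rfl fun z _ => ?_
    -- Splitting the symbol of index `β + z` in both orders moves the dependence on `z` out of the
    -- factor of index `β`.
    have h2 := mpoch_add (fun i => κ.1 i + 1 + α.1 i) β z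
    rw [add_comm β z, mpoch_add] at h2
    have h3 : kpoch κ (α.1 + z) = kpoch κ α.1 * mpoch (fun i => κ.1 i + 1 + α.1 i) z :=
      mpoch_add _ _ _
    have h4 : mpoch (fun i => κ.1 i + 1 + ((α.1 + z) i : ℕ)) β =
        mpoch (fun i => κ.1 i + 1 + α.1 i + z i) β := by
      congr 1
      funext i
      simp only [Pi.add_apply]
      push_cast
      ring
    have h5 := prod_descFactorial_add_div_mfact α.1 z
    rw [neg_one_pow_mul_mpoch_neg, hahnWeight, h3, h4]
    have hk := (kpoch_pos κ α.1).ne'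
    calc _ = ((∏ i, (((α.1 + z) i).descFactorial (α.1 i) : ℝ)) / mfact (α.1 + z)) *
          (mpoch (fun i => κ.1 i + 1 + α.1 i) z *
            mpoch (fun i => κ.1 i + 1 + α.1 i + z i) β) * (kpoch κ α.1 / kpoch κ α.1) := by ring
      _ = _ := by rw [h5, h2, div_self hk]; ring
  · intro x hx
    rw [neg_one_pow_mul_mpoch_neg, prod_descFactorial_eq_zero hx, zero_mul, zero_mul]

end

section

open MvPolynomial

/-! ### Polynomials modulo lower degree -/

/-- The polynomials of total degree less than `k`. -/
def degreeLT (d k : ℕ) : Submodule ℝ (MvPolynomial (Fin d) ℝ) :=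
  restrictSupport ℝ {s | s.degree < k}

theorem degreeLT_mono (d : ℕ) {k l : ℕ} (h : k ≤ l) : degreeLT d k ≤ degreeLT d l :=
  restrictSupport_mono ℝ fun _ hs => lt_of_lt_of_le hs h

theorem degreeLT_zero (d : ℕ) : degreeLT d 0 = ⊥ := by
  simp [degreeLT, restrictSupport_eq_span]

theorem degreeLT_succ (d n : ℕ) : degreeLT d (n + 1) = restrictTotalDegree (Fin d) ℝ n := by
  rw [degreeLT, restrictTotalDegree]
  congr 1
  ext s
  simp [Finsupp.degree_eq_sum, Finsupp.sum_fintype]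

theorem monomial_mem_degreeLT {d k : ℕ} {s : Fin d →₀ ℕ} (h : s.degree < k) (c : ℝ) :
    monomial s c ∈ degreeLT d k :=
  monomial_mem_restrictSupport ℝ |>.mpr (Or.inl h)

/-- One strict and one non-strict degree bound add to a strict one, as needed for remainders of
products of monic polynomials. -/
theorem mul_mem_degreeLT {d a b : ℕ} {p q : MvPolynomial (Fin d) ℝ} (hp : p ∈ degreeLT d a)
    (hq : q ∈ degreeLT d (b + 1)) : p * q ∈ degreeLT d (a + b) := by
  have h := Submodule.mul_mem_mul hp hq
  rw [degreeLT, degreeLT, ← restrictSupport_add] at h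
  refine restrictSupport_mono ℝ ?_ h
  rintro _ ⟨s, hs, t, ht, rfl⟩
  simp only [Set.mem_ofPred_eq, map_add] at hs ht ⊢
  omega

/-- `p` is monic with leading monomial `X ^ s`, up to terms of degree less than `|s|`. -/
def HasLeadingMonomial {d : ℕ} (p : MvPolynomial (Fin d) ℝ) (s : Fin d →₀ ℕ) : Prop :=
  p - monomial s 1 ∈ degreeLT d s.degree

namespace HasLeadingMonomial

variable {d : ℕ}

theorem mem {p : MvPolynomial (Fin d) ℝ} {s : Fin d →₀ ℕ} (h : HasLeadingMonomial p s) :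
    p ∈ degreeLT d (s.degree + 1) := by
  rw [← sub_add_cancel p (monomial s 1)]
  exact add_mem (degreeLT_mono d (Nat.le_succ _) h) (monomial_mem_degreeLT (Nat.lt_succ_self _) _)

theorem one : HasLeadingMonomial (1 : MvPolynomial (Fin d) ℝ) 0 := by
  have : (1 : MvPolynomial (Fin d) ℝ) - monomial 0 1 = 0 := sub_self _
  rw [HasLeadingMonomial, this]
  exact zero_mem _

theorem mul {p q : MvPolynomial (Fin d) ℝ} {s t : Fin d →₀ ℕ} (hp : HasLeadingMonomial p s)
    (hq : HasLeadingMonomial q t) : HasLeadingMonomial (p * q) (s + t) := by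
  have h : p * q - monomial (s + t) 1 =
      (p - monomial s 1) * q + (q - monomial t 1) * monomial s 1 := by
    have : (monomial (s + t) 1 : MvPolynomial (Fin d) ℝ) = monomial s 1 * monomial t 1 := by
      rw [monomial_mul, one_mul]
    rw [this]
    ring
  rw [HasLeadingMonomial, h, map_add]
  refine add_mem (mul_mem_degreeLT hp hq.mem) ?_
  rw [add_comm]
  exact mul_mem_degreeLT hq (monomial_mem_degreeLT (Nat.lt_succ_self _) _)

theorem prod {ι : Type*} (I : Finset ι) {p : ι → MvPolynomial (Fin d) ℝ} {s : ι → Fin d →₀ ℕ}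
    (h : ∀ i ∈ I, HasLeadingMonomial (p i) (s i)) :
    HasLeadingMonomial (∏ i ∈ I, p i) (∑ i ∈ I, s i) := by
  classical
  induction I using Finset.induction_on with
  | empty => simpa using one
  | insert i I hi ih =>
    rw [Finset.prod_insert hi, Finset.sum_insert hi]
    exact (h i (Finset.mem_insert_self i I)).mul
      (ih fun j hj => h j (Finset.mem_insert_of_mem hj))

theorem X_add_C (i : Fin d) (c : ℝ) :
    HasLeadingMonomial (X i + C c : MvPolynomial (Fin d) ℝ) (Finsupp.single i 1) := by
  have h : (X i + C c : MvPolynomial (Fin d) ℝ) - monomial (Finsupp.single i 1) 1 =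
      monomial 0 c := by
    rw [X, C_apply]; ring
  rw [HasLeadingMonomial, h]
  exact monomial_mem_degreeLT (by simp) _

end HasLeadingMonomial

/-- The polynomial `∏ᵢ ∏_{j < βᵢ} (Xᵢ + cᵢⱼ)`. -/
def shiftedProduct {d : ℕ} (c : Fin d → ℕ → ℝ) (β : Fin d →₀ ℕ) : MvPolynomial (Fin d) ℝ :=
  ∏ i, ∏ j ∈ Finset.range (β i), (X i + C (c i j))

theorem hasLeadingMonomial_shiftedProduct {d : ℕ} (c : Fin d → ℕ → ℝ) (β : Fin d →₀ ℕ) :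
    HasLeadingMonomial (shiftedProduct c β) β := by
  have h := HasLeadingMonomial.prod Finset.univ fun i _ =>
    HasLeadingMonomial.prod (Finset.range (β i)) fun j _ => HasLeadingMonomial.X_add_C i (c i j)
  simp only [Finset.sum_const, Finset.card_range, Finsupp.smul_single, smul_eq_mul, mul_one,
    Finsupp.univ_sum_single] at h
  exact h

/-- Two linear maps that are proportional on polynomials with prescribed leading monomials are
proportional, modulo lower degree, on all polynomials. -/
theorem sub_smul_mem_map_degreeLT {d K : ℕ} {F : Type*} [AddCommGroup F] [Module ℝ F]
    (A B : MvPolynomial (Fin d) ℝ →ₗ[ℝ] F) (τ : ℕ → ℝ)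
    (b : (Fin d →₀ ℕ) → MvPolynomial (Fin d) ℝ) (hb : ∀ β, HasLeadingMonomial (b β) β)
    (hAB : ∀ β, β.degree ≤ K → A (b β) = τ β.degree • B (b β)) :
    ∀ k ≤ K, ∀ p ∈ degreeLT d (k + 1), A p - τ k • B p ∈ (degreeLT d k).map B := by
  intro k
  induction k using Nat.strong_induction_on with
  | _ k ih =>
    intro hk
    -- The induction hypothesis one degree down shows that `A` sends lower-degree polynomials into
    -- the lower-degree image of `B`, so only monomials of degree exactly `k` remain.
    have hlow : ∀ p ∈ degreeLT d k, A p ∈ (degreeLT d k).map B := by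
      intro p hp
      rcases k with _ | k
      · rw [degreeLT_zero, Submodule.mem_bot] at hp
        rw [hp, map_zero]
        exact zero_mem _
      · have h := ih k (Nat.lt_succ_self k) (by omega) p hp
        rw [← sub_add_cancel (A p) (τ k • B p)]
        exact add_mem (Submodule.map_mono (degreeLT_mono d (Nat.le_succ k)) h)
          (Submodule.smul_mem _ _ (Submodule.mem_map_of_mem hp))
    suffices h : degreeLT d (k + 1) ≤ ((degreeLT d k).map B).comap (A - τ k • B) from
      fun p hp => h hp
    have hlow' : degreeLT d k ≤ ((degreeLT d k).map B).comap (A - τ k • B) := fun p hp =>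
      sub_mem (hlow p hp) (Submodule.smul_mem _ _ (Submodule.mem_map_of_mem hp))
    conv_lhs => rw [degreeLT, restrictSupport_eq_span]
    rw [Submodule.span_le]
    rintro _ ⟨s, hs, rfl⟩
    rcases Nat.lt_succ_iff_lt_or_eq.mp hs with hs | rfl
    · exact hlow' (monomial_mem_degreeLT hs _)
    -- The top monomial is `b s` minus a lower-degree polynomial, and `A - τ k • B` annihilates `b
    -- s`.
    · have h0 : b s ∈ ((degreeLT d s.degree).map B).comap (A - τ s.degree • B) := by
        change A (b s) - τ s.degree • B (b s) ∈ (degreeLT d s.degree).map B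
        rw [hAB s hk, sub_self]
        exact zero_mem _
      have h := sub_mem h0 (hlow' (hb s))
      rwa [sub_sub_cancel] at h

end

section

open MvPolynomial

/-! ### The operators on polynomials -/

/-- A multi-index in `d` variables, extended by `0`. -/
def extendZero {d : ℕ} (β : Fin d →₀ ℕ) : Fin (d + 1) → ℕ := Fin.snoc (α := fun _ => ℕ) β 0

theorem extendZero_mem_grid {d : ℕ} (β : Fin d →₀ ℕ) : extendZero β ∈ grid d β.degree := by
  rw [mem_grid, Fin.sum_univ_castSucc]
  simp [extendZero, Finsupp.degree_eq_sum]

theorem mpoch_extendZero {d : ℕ} (a : Fin (d + 1) → ℝ) (β : Fin d →₀ ℕ) :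
    mpoch a (extendZero β) = ∏ i : Fin d, poch (a i.castSucc) (β i) := by
  rw [mpoch, Fin.prod_univ_castSucc]
  simp [extendZero, poch_zero]

variable {d : ℕ} (κ : Param d)

theorem restrict_shiftedProduct (N : ℕ) (c : Fin d → ℕ → ℝ) (β : Fin d →₀ ℕ) (x : grid d N) :
    HahnSpace.restrict κ N (shiftedProduct c β) x =
      ∏ i : Fin d, ∏ j ∈ Finset.range (β i), ((x.1 i.castSucc : ℝ) + c i j) := by
  change eval _ (shiftedProduct c β) = _
  simp [shiftedProduct, map_prod]

theorem restrict_shiftedProduct_neg (N : ℕ) (β : Fin d →₀ ℕ) :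
    HahnSpace.restrict κ N (shiftedProduct (fun _ j => -(j : ℝ)) β) =
      shiftedMonomial κ N (extendZero β) := by
  funext x
  rw [restrict_shiftedProduct]
  change _ = (-1) ^ (∑ i, extendZero β i) * mpoch (fun i => -(x.1 i : ℝ)) (extendZero β)
  rw [mpoch_extendZero, mem_grid.mp (extendZero_mem_grid β), Finsupp.degree_eq_sum,
    ← Finset.prod_pow_eq_pow_sum, ← Finset.prod_mul_distrib]
  exact Finset.prod_congr rfl fun i _ => by simp [neg_one_pow_mul_poch_neg, sub_eq_add_neg]

theorem restrict_shiftedProduct_rising (N : ℕ) (β : Fin d →₀ ℕ) :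
    HahnSpace.restrict κ N (shiftedProduct (fun i j => κ.1 i.castSucc + 1 + j) β) =
      risingMonomial κ N (extendZero β) := by
  funext x
  rw [restrict_shiftedProduct]
  change _ = mpoch (fun i => κ.1 i + 1 + x.1 i) (extendZero β)
  rw [mpoch_extendZero]
  exact Finset.prod_congr rfl fun i _ => Finset.prod_congr rfl fun j _ => by ring

theorem synthesis_restrict {m N k : ℕ} (hk : k ≤ m) {p : MvPolynomial (Fin d) ℝ}
    (hp : p ∈ degreeLT d (k + 1)) :
    synthesis κ m N (HahnSpace.restrict κ m p) -
        synthesisCoeff k m N • HahnSpace.restrict κ N p ∈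
      (degreeLT d k).map (HahnSpace.restrict κ N) := by
  refine sub_smul_mem_map_degreeLT (synthesis κ m N ∘ₗ HahnSpace.restrict κ m)
    (HahnSpace.restrict κ N) (fun k => synthesisCoeff k m N)
    (shiftedProduct fun _ j => -(j : ℝ)) (hasLeadingMonomial_shiftedProduct _) ?_ k hk p hp
  intro β hβ
  rw [LinearMap.comp_apply, restrict_shiftedProduct_neg, restrict_shiftedProduct_neg]
  exact synthesis_shiftedMonomial κ m N hβ (extendZero_mem_grid β)

theorem analysis_restrict {m N : ℕ} (hmN : m ≤ N) (k : ℕ) {p : MvPolynomial (Fin d) ℝ}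
    (hp : p ∈ degreeLT d (k + 1)) :
    analysis κ m N (HahnSpace.restrict κ N p) -
        analysisCoeff κ m N k • HahnSpace.restrict κ m p ∈
      (degreeLT d k).map (HahnSpace.restrict κ m) := by
  refine sub_smul_mem_map_degreeLT (analysis κ m N ∘ₗ HahnSpace.restrict κ N)
    (HahnSpace.restrict κ m) (analysisCoeff κ m N)
    (shiftedProduct fun i j => κ.1 i.castSucc + 1 + j)
    (hasLeadingMonomial_shiftedProduct _) ?_ k le_rfl p hp
  intro β _
  rw [LinearMap.comp_apply, restrict_shiftedProduct_rising, restrict_shiftedProduct_rising]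
  exact analysis_risingMonomial κ m N hmN (extendZero_mem_grid β)

theorem synthesis_mem_map_degreeLT {m N k : ℕ} (hk : k ≤ m) {q : MvPolynomial (Fin d) ℝ}
    (hq : q ∈ degreeLT d k) :
    synthesis κ m N (HahnSpace.restrict κ m q) ∈
      (degreeLT d k).map (HahnSpace.restrict κ N) := by
  rcases k with _ | k
  · rw [degreeLT_zero, Submodule.mem_bot] at hq
    rw [hq, map_zero, map_zero]
    exact zero_mem _
  · have h := synthesis_restrict κ (N := N) (Nat.le_of_succ_le hk) hq
    rw [← sub_add_cancel (synthesis κ m N (HahnSpace.restrict κ m q))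
      (synthesisCoeff k m N • HahnSpace.restrict κ N q)]
    exact add_mem (Submodule.map_mono (degreeLT_mono d (Nat.le_succ k)) h)
      (Submodule.smul_mem _ _ (Submodule.mem_map_of_mem hq))

/-- `synthesis ∘ analysis` acts on polynomials of degree `n` as a scalar, modulo lower degree. -/
theorem synthesis_analysis_sub_mem {m N n : ℕ} (hnm : n ≤ m) (hmN : m ≤ N) {f : HahnSpace κ N}
    (hf : f ∈ polySpace κ N n) :
    synthesis κ m N (analysis κ m N f) - (analysisCoeff κ m N n * synthesisCoeff n m N) • f ∈
      (degreeLT d n).map (HahnSpace.restrict κ N) := by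
  rw [polySpace, ← degreeLT_succ] at hf
  obtain ⟨p, hp, rfl⟩ := hf
  -- `q` is the lower-degree remainder of `analysis`; `synthesis` keeps it in lower degree.
  obtain ⟨q, hq, hq'⟩ := analysis_restrict κ hmN n hp
  have h1 := Submodule.smul_mem _ (analysisCoeff κ m N n)
    (synthesis_restrict κ (N := N) hnm hp)
  have h := add_mem h1 (synthesis_mem_map_degreeLT κ (N := N) hnm hq)
  rw [hq', map_sub, map_smul, smul_sub, smul_smul] at h
  rwa [sub_add_sub_comm, add_comm, add_sub_add_right_eq_sub] at h

/-! ### Projection onto the space of orthogonal polynomials -/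

/-- Allows the projection onto `V_n` to discard every lower-degree remainder. -/
theorem map_degreeLT_le_orthogonal (N n : ℕ) :
    (degreeLT d n).map (HahnSpace.restrict κ N) ≤ (orthoSpace κ N n)ᗮ := by
  rcases n with _ | n
  · rw [degreeLT_zero, Submodule.map_bot]
    exact bot_le
  · intro g hg f hf
    rw [degreeLT_succ] at hg
    exact hf.2 n (Nat.lt_succ_self n) g hg

theorem starProjection_synthesis_analysis {m N n : ℕ} (hnm : n ≤ m) (hmN : m ≤ N)
    {f : HahnSpace κ N} (hf : f ∈ orthoSpace κ N n) :
    (orthoSpace κ N n).starProjection (synthesis κ m N (analysis κ m N f)) =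
      (analysisCoeff κ m N n * synthesisCoeff n m N) • f := by
  have h := map_degreeLT_le_orthogonal κ N n (synthesis_analysis_sub_mem κ hnm hmN hf.1)
  rw [← Submodule.starProjection_apply_eq_zero_iff, map_sub, map_smul,
    Submodule.starProjection_eq_self_iff.mpr hf, sub_eq_zero] at h
  exact h

/-- Here `synthesisCoeff n m N` is the binomial coefficient of `N - n` over `m - n`; the rest is
factorials and the splitting of `(λ)_{N+n}` at `m + n`. -/
theorem constD_mul_coeff {m N n : ℕ} (hnm : n ≤ m) (hmN : m ≤ N) :
    constD κ n m N * (analysisCoeff κ m N n * synthesisCoeff n m N) = 1 := by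
  have hN : ((N : ℝ) - n) = ((N - n : ℕ) : ℝ) := by rw [Nat.cast_sub (hnm.trans hmN)]
  have e1 : lam κ + m + n = lam κ + (m + n : ℕ) := by push_cast; ring
  have e2 : poch (lam κ) (N + n) =
      poch (lam κ) (m + n) * poch (lam κ + m + n) (N - m) := by
    rw [e1, ← poch_add]
    congr 1
    omega
  have p1 := (poch_pos (lam_pos κ) N).ne'
  have p2 := (poch_pos (lam_pos κ) (m + n)).ne'
  have p3 : poch (lam κ + m + n) (N - m) ≠ 0 := by
    rw [e1]
    exact (poch_pos (add_pos_of_pos_of_nonneg (lam_pos κ) (Nat.cast_nonneg _)) _).ne'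
  have hf : ∀ a b : ℕ, b ≤ a → (a.descFactorial b : ℝ) =
      (a.factorial : ℝ) / ((a - b).factorial : ℝ) := by
    intro a b hab
    rw [eq_div_iff (by exact_mod_cast Nat.factorial_ne_zero _), mul_comm]
    exact_mod_cast Nat.factorial_mul_descFactorial hab
  have hfac : ∀ a : ℕ, (a.factorial : ℝ) ≠ 0 := fun a => by
    exact_mod_cast Nat.factorial_ne_zero a
  have hs : ∀ a : ℕ, ((-1 : ℝ) ^ a) ≠ 0 := fun a => pow_ne_zero _ (by norm_num)
  have hm2 : ((-1 : ℝ) ^ m) ^ 2 = 1 := by rw [← pow_mul, mul_comm, pow_mul]; simp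
  rw [synthesisCoeff, hN, neg_one_pow_mul_poch_neg_natCast, analysisCoeff, constD, e2,
    poch_neg_natCast, poch_neg_natCast, poch_neg_natCast, mul_pow, hm2, hf _ _ hmN, hf _ _ hnm,
    hf _ _ (hnm.trans hmN), hf (N - n) (m - n) (by omega),
    show N - n - (m - n) = N - m by omega]
  have f1 := hfac N
  have f2 := hfac m
  have f3 := hfac (N - n)
  have f4 := hfac (N - m)
  have f5 := hfac (m - n)
  have f6 := hs n
  field_simp

/-- Self-adjointness gives `⟨proj m_α, f⟩ = ⟨m_α, f⟩` for `f ∈ V_n`; one of the two normalisations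
`1 / (κ + 𝟏)_α` cancels against the weight, the other belongs to `analysis`. -/
theorem sum_hahnQ_smul {m N n : ℕ} (hnm : n ≤ m) (hmN : m ≤ N) {f : HahnSpace κ N}
    (hf : f ∈ orthoSpace κ N n) :
    ∑ α ∈ grid d m, (kpoch κ α / mfact α * inner ℝ (hahnQ κ N n α) f) • hahnQ κ N n α =
      (analysisCoeff κ m N n * synthesisCoeff n m N) • f := by
  rw [← starProjection_synthesis_analysis κ hnm hmN hf, ← Finset.sum_coe_sort]
  change _ = (orthoSpace κ N n).starProjection (∑ α : grid d m,
    (inner ℝ (shiftedMonomial κ N α.1) f / kpoch κ α.1 / mfact α.1) • shiftedMonomial κ N α.1)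
  rw [map_sum]
  refine Finset.sum_congr rfl fun α _ => ?_
  have hk := (kpoch_pos κ α.1).ne'
  have hm := (mfact_pos α.1).ne'
  rw [map_smul, hahnQ, real_inner_smul_left, Submodule.inner_starProjection_left_eq_right,
    Submodule.starProjection_eq_self_iff.mpr hf, smul_smul]
  congr 1
  field_simp

end

end HahnFrame

end

/-! ### The kernel formula, by uniqueness of the reproducing kernel -/

theorem theorem3p3 (d n m N : ℕ) (hnm : n ≤ m) (hmN : m ≤ N) (κ : HahnFrame.Param d)
    (x y : HahnFrame.grid d N) :
    HahnFrame.reproducingKernel (HahnFrame.orthoSpace κ N n) x y =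
      HahnFrame.constD κ n m N *
        ∑ α ∈ HahnFrame.grid d m,
          HahnFrame.kpoch κ α / HahnFrame.mfact α *
            HahnFrame.hahnQ κ N n α x * HahnFrame.hahnQ κ N n α y := by
  set K : HahnFrame.grid d N → HahnFrame.grid d N → ℝ := fun x y =>
    HahnFrame.constD κ n m N * ∑ α ∈ HahnFrame.grid d m,
      HahnFrame.kpoch κ α / HahnFrame.mfact α *
        HahnFrame.hahnQ κ N n α x * HahnFrame.hahnQ κ N n α y with hK
  have hrow : ∀ x, HahnFrame.HahnSpace.of κ N (fun y => K x y) =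
      HahnFrame.constD κ n m N • ∑ α ∈ HahnFrame.grid d m,
        (HahnFrame.kpoch κ α / HahnFrame.mfact α * HahnFrame.hahnQ κ N n α x) •
          HahnFrame.hahnQ κ N n α := by
    intro x
    funext y
    exact congrArg (HahnFrame.constD κ n m N * ·) (HahnFrame.sum_apply κ N _
      (fun α => (HahnFrame.kpoch κ α / HahnFrame.mfact α * HahnFrame.hahnQ κ N n α x) •
        HahnFrame.hahnQ κ N n α) y).symm
  have hsymm : ∀ x y, K x y = K y x := fun x y =>
    congrArg (HahnFrame.constD κ n m N * ·) (Finset.sum_congr rfl fun α _ => by ring)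
  have hmem : ∀ x, HahnFrame.HahnSpace.of κ N (fun y => K x y) ∈ HahnFrame.orthoSpace κ N n := by
    intro x
    rw [hrow]
    exact Submodule.smul_mem _ _ (Submodule.sum_mem _ fun α _ => Submodule.smul_mem _ _
      (Submodule.smul_mem _ _ (Submodule.starProjection_apply_mem _ _)))
  have h : K = HahnFrame.reproducingKernel (HahnFrame.orthoSpace κ N n) := by
    refine (HahnFrame.eq_reproducingKernel_iff _ K).mpr ⟨hmem, fun y => ?_, fun p hp x => ?_⟩
    · simp only [hsymm _ y]
      exact hmem y
    · have h1 := congrArg (fun f : HahnFrame.HahnSpace κ N => HahnFrame.constD κ n m N * f x)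
        (HahnFrame.sum_hahnQ_smul κ hnm hmN hp)
      have h2 : HahnFrame.constD κ n m N *
          ((HahnFrame.analysisCoeff κ m N n * HahnFrame.synthesisCoeff n m N) * p x) = p x := by
        rw [← mul_assoc, HahnFrame.constD_mul_coeff κ hnm hmN, one_mul]
      rw [hrow, real_inner_smul_left, sum_inner]
      refine Eq.trans (congrArg (HahnFrame.constD κ n m N * ·) ?_) (h1.trans h2)
      refine Eq.trans (Finset.sum_congr rfl fun α _ => ?_)
        (HahnFrame.sum_apply κ N _ _ x).symm
      rw [real_inner_smul_left]
      exact mul_right_comm _ _ _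
  exact (congrFun (congrFun h x) y).symm
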